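/- **Notation.** All logarithms are natural. For random variables $U,V,W$ let $I(U;V\mid W)=D_{\mathrm{KL}}\big(P_{WUV}\,\|\,P_W\otimes(P_{U|W}\times P_{V|W})\big)$ be the conditional mutual information. A randomized mechanism $M$ acting on databases $x=(x_1,\dots,x_n)\in(\mathbb R^d)^n$ is *$\varepsilon$-MI DP over a class $\Theta$ of laws on $(\mathbb R^d)^n$* if $$\sup_{P\in\Theta,\ 1\le i\le n} I\big(X_i;M(X)\,\big|\,(X_j)_{j\ne i}\big)\le\varepsilon ,\qquad X=(X_1,\dots,X_n)\sim P .$$ **Algorithm.** Input: $x\in(\mathbb R^d)^n$, $\varepsilon>0$, $\beta\in(0,1)$ and a second moment bound $c>0$. Put $$m=\lceil 200\log(1/\beta)\rceil,\qquad k=\lfloor n/m\rfloor,\qquad \sigma^2=\frac{d\,c}{2k^2\varepsilon},$$ $$\tilde\mu_p=\frac1k\sum_{i=(p-1)k+1}^{pk}x_i+Z_p\quad(p=1,\dots,m),\qquad Z_1,\dots,Z_m\ \text{i.i.d.}\ \mathcal N(0,\sigma^2 I_d),$$ and output a geometric median $\hat\mu_n\in\arg\min_{y\in\mathbb R^d}\sum_{p=1}^m\|y-\tilde\mu_p\|$,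 where $\|\cdot\|$ is the Euclidean norm and ties are broken by an arbitrary fixed measurable rule. The algorithm is run with $n\ge m$, so that $k\ge1$. **Proposition (mean estimation under $\varepsilon$-MI DP).** For every $c>0$ there is a constant $C>0$, depending only on $c$, such that for all $d\ge1$, $\alpha,\varepsilon>0$, $\beta\in(0,1)$, all $n\ge m$ and every measurable tie-breaking rule the following holds. 1. (Privacy) The map $x\mapsto\hat\mu_n$ is $\varepsilon$-MI DP over the class of all laws on $(\mathbb R^d)^n$ whose rows have finite second moments with $\mathbb E\|X_i-\mathbb E X_i\|^2\le c$ for all $i$; in particular this holds for i.i.d. samples of any distribution with second central moment at most $c$. 2. (Accuracy) If $$n\ \ge\ C\,\max\{1,\log(1/\beta)\}\left(\frac{d}{\alpha^2}+\frac{d}{\alpha\sqrt{\varepsilon}}\right),$$ and the algorithm is fed with $n$ i.i.d. samples of a distribution on $\mathbb R^d$ with mean $\mu$ and finite second moment with $\mathbb E\|X-\mu\|^2\le c$, then $$\mathbb P\big(\|\hat\mu_n-\mu\|\le\alpha\big)\ge1-\beta .$$ -/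

import Mathlib

open MeasureTheory ProbabilityTheory Filter Topology

open scoped ENNReal

noncomputable section

namespace MIPrivacy

/-! ### Conditional mutual information and mutual information differential privacy -/

section Privacy

variable {Ω 𝓤 𝓥 𝓦 : Type*} [MeasurableSpace Ω]
  [MeasurableSpace 𝓤] [StandardBorelSpace 𝓤] [Nonempty 𝓤]
  [MeasurableSpace 𝓥] [StandardBorelSpace 𝓥] [Nonempty 𝓥] [MeasurableSpace 𝓦]

/-- The conditional mutual information `I(U; V | W)` (in nats) of random variables on `(Ω, P)`:
the Kullback–Leibler divergence of the joint law `P_{W,U,V}` from `P_W ⊗ (P_{U|W} × P_{V|W})`. -/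
def condMutualInfo (P : Measure Ω) [IsFiniteMeasure P] (U : Ω → 𝓤) (V : Ω → 𝓥) (W : Ω → 𝓦) :
    ℝ≥0∞ :=
  InformationTheory.klDiv (P.map fun ω => (W ω, U ω, V ω))
    ((P.map W) ⊗ₘ (condDistrib U W P ×ₖ condDistrib V W P))

variable {𝓧 𝓨 : Type*} [MeasurableSpace 𝓧] [StandardBorelSpace 𝓧] [Nonempty 𝓧]
  [MeasurableSpace 𝓨] [StandardBorelSpace 𝓨] [Nonempty 𝓨]

/-- A randomized mechanism `M` (the kernel `x ↦ law of M(x)`) acting on databases with `n` rows is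
`ε`-mutual information differentially private over the class `Θ` of database laws if
`sup_{P ∈ Θ, i} I(X_i; M(X) | (X_j)_{j ≠ i}) ≤ ε`, where `X ∼ P`. -/
def IsMIDP {n : ℕ} (M : Kernel (Fin n → 𝓧) 𝓨) [IsMarkovKernel M] (ε : ℝ)
    (Θ : Set (ProbabilityMeasure (Fin n → 𝓧))) : Prop :=
  ⨆ P ∈ Θ, ⨆ i : Fin n,
    condMutualInfo ((P : Measure (Fin n → 𝓧)) ⊗ₘ M)
      (fun q => q.1 i) (fun q => q.2) (fun q => fun j : {j : Fin n // j ≠ i} => q.1 j)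
    ≤ ENNReal.ofReal ε

end Privacy

/-- Laws on databases with `n` rows in `ℝ^d` (the rows may be dependent) such that every row has a
finite second moment and satisfies `E‖X_i - E X_i‖² ≤ c`. -/
def secondMomentClass (n d : ℕ) (c : ℝ) :
    Set (ProbabilityMeasure (Fin n → EuclideanSpace ℝ (Fin d))) :=
  {P | ∀ i, MemLp (fun x => x i) 2 (P : Measure (Fin n → EuclideanSpace ℝ (Fin d))) ∧
    ∫ x, ‖x i - ∫ x', x' i ∂(P : Measure (Fin n → EuclideanSpace ℝ (Fin d)))‖ ^ 2
      ∂(P : Measure (Fin n → EuclideanSpace ℝ (Fin d))) ≤ c}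

/-! ### Geometric medians -/

/-- `y` is a geometric median of `v_1, …, v_m`, that is, `y ∈ argmin_z ∑ p, ‖z - v_p‖`. -/
def IsGeometricMedian {m d : ℕ} (v : Fin m → EuclideanSpace ℝ (Fin d))
    (y : EuclideanSpace ℝ (Fin d)) : Prop :=
  ∀ z, ∑ p, ‖y - v p‖ ≤ ∑ p, ‖z - v p‖

/-- A measurable choice of a geometric median of `m` points (minimizers need not be unique). -/
structure MedianSelector (m d : ℕ) where
  toFun : (Fin m → EuclideanSpace ℝ (Fin d)) → EuclideanSpace ℝ (Fin d)
  measurable : Measurable toFun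
  isGeometricMedian : ∀ v, IsGeometricMedian v (toFun v)

/-- Jointly regular families of convex functions that attain their minima have a measurable choice
of minimizers; this makes the choice of a geometric median below legitimate. -/
theorem exists_measurable_minimizer {X E : Type*} [PseudoMetricSpace X] [MeasurableSpace X]
    [BorelSpace X] [NormedAddCommGroup E] [InnerProductSpace ℝ E] [FiniteDimensional ℝ E]
    [MeasurableSpace E] [BorelSpace E] (F : X → E → ℝ)
    (hconv : ∀ x y z, F x ((1 / 2 : ℝ) • (y + z)) ≤ (F x y + F x z) / 2)
    (hcont : ∀ x, Continuous (F x)) (hnn : ∀ x y, 0 ≤ F x y)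
    (hex : ∀ x, ∃ y, ∀ z, F x y ≤ F x z)
    (K : ℝ) (hlip : ∀ x x' y, |F x y - F x' y| ≤ K * dist x x') :
    ∃ g : X → E, Measurable g ∧ ∀ x z, F x (g x) ≤ F x z := by
  have key : ∀ (x : X) (t : ℝ), 0 < t → ∃ y, ∀ z, F x y + t * ‖y‖ ^ 2 ≤ F x z + t * ‖z‖ ^ 2 := by
    intro x t ht
    refine Continuous.exists_forall_le (by have := hcont x; fun_prop) ?_
    refine tendsto_atTop_mono (f := fun z => t * ‖z‖ ^ 2) (fun z => by linarith [hnn x z]) ?_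
    exact (((tendsto_pow_atTop two_ne_zero).comp tendsto_norm_cocompact_atTop)).const_mul_atTop ht
  choose! y hy using key
  have strong : ∀ x t, 0 < t → ∀ z,
      F x (y x t) + t * ‖y x t‖ ^ 2 + t / 2 * ‖y x t - z‖ ^ 2 ≤ F x z + t * ‖z‖ ^ 2 := by
    intro x t ht z
    have h1 := hy x t ht ((1 / 2 : ℝ) • (y x t + z))
    have h2 := hconv x (y x t) z
    have h3 := parallelogram_law_with_norm ℝ (y x t) z
    have h4 : ‖(1 / 2 : ℝ) • (y x t + z)‖ ^ 2 = ‖y x t + z‖ ^ 2 / 4 := by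
      rw [norm_smul, mul_pow]; norm_num; ring
    rw [h4] at h1
    nlinarith
  have hmeas : ∀ t, 0 < t → Measurable fun x => y x t := by
    intro t ht
    refine Continuous.measurable (continuous_iff_continuousAt.2 fun x => ?_)
    rw [ContinuousAt, tendsto_iff_norm_sub_tendsto_zero]
    have hb : ∀ x', ‖y x' t - y x t‖ ^ 2 ≤ 4 * K / t * dist x x' := by
      intro x'
      have h1 := strong x t ht (y x' t)
      have h2 := hy x' t ht (y x t)
      have h3 := abs_le.1 (hlip x x' (y x t))
      have h4 := abs_le.1 (hlip x x' (y x' t))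
      rw [norm_sub_rev] at h1
      have : t / 2 * ‖y x' t - y x t‖ ^ 2 ≤ 2 * (K * dist x x') := by linarith
      calc ‖y x' t - y x t‖ ^ 2 = 2 / t * (t / 2 * ‖y x' t - y x t‖ ^ 2) := by field_simp
        _ ≤ 2 / t * (2 * (K * dist x x')) := by gcongr
        _ = _ := by ring
    have hd : Tendsto (fun x' => √(4 * K / t * dist x x')) (𝓝 x) (𝓝 0) := by
      have : Continuous fun x' => √(4 * K / t * dist x x') := by fun_prop
      simpa using this.tendsto x
    refine squeeze_zero (fun _ => norm_nonneg _) (fun x' => ?_) hd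
    exact Real.le_sqrt_of_sq_le (hb x')
  have hlim : ∀ x, ∃ l, Tendsto (fun k : ℕ => y x (1 / ((k : ℝ) + 1))) atTop (𝓝 l) := by
    intro x
    have hpos : ∀ k : ℕ, (0 : ℝ) < 1 / ((k : ℝ) + 1) := fun k => by positivity
    have hstep : ∀ j k : ℕ, k ≤ j →
        ‖y x (1 / ((k : ℝ) + 1)) - y x (1 / ((j : ℝ) + 1))‖ ^ 2 / 2 ≤
          ‖y x (1 / ((j : ℝ) + 1))‖ ^ 2 - ‖y x (1 / ((k : ℝ) + 1))‖ ^ 2 := by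
      intro j k hkj
      have hle : 1 / ((j : ℝ) + 1) ≤ 1 / ((k : ℝ) + 1) := by gcongr
      have h1 := strong x _ (hpos k) (y x (1 / ((j : ℝ) + 1)))
      have h2 := strong x _ (hpos j) (y x (1 / ((k : ℝ) + 1)))
      rw [norm_sub_rev] at h2
      have hs := hpos j
      have ht := hpos k
      generalize 1 / ((j : ℝ) + 1) = s at *
      generalize 1 / ((k : ℝ) + 1) = t at *
      have hA : (t + s) * (‖y x t - y x s‖ ^ 2 / 2) ≤
          (t - s) * (‖y x s‖ ^ 2 - ‖y x t‖ ^ 2) := by nlinarith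
      have hN : 0 ≤ ‖y x t - y x s‖ ^ 2 := by positivity
      rcases hle.eq_or_lt with he | hlt
      · subst he; simp
      · by_contra! hc
        have h5 : (t - s) * (‖y x s‖ ^ 2 - ‖y x t‖ ^ 2) < (t - s) * (‖y x t - y x s‖ ^ 2 / 2) :=
          mul_lt_mul_of_pos_left hc (by linarith)
        nlinarith
    obtain ⟨z, hz⟩ := hex x
    set a : ℕ → ℝ := fun k => ‖y x (1 / ((k : ℝ) + 1))‖ ^ 2 with ha
    have hmono : Monotone a := by
      intro k j hkj
      have := hstep j k hkj
      have h0 : 0 ≤ ‖y x (1 / ((k : ℝ) + 1)) - y x (1 / ((j : ℝ) + 1))‖ ^ 2 / 2 := by positivity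
      simp only [ha]; linarith
    have hbdd : BddAbove (Set.range a) := by
      refine ⟨‖z‖ ^ 2, ?_⟩
      rintro _ ⟨k, rfl⟩
      have h1 := hy x _ (hpos k) z
      have h2 := hz (y x (1 / ((k : ℝ) + 1)))
      exact le_of_mul_le_mul_left (by simp only [ha]; linarith) (hpos k)
    have hcau : CauchySeq a := (tendsto_atTop_ciSup hmono hbdd).cauchySeq
    refine cauchySeq_tendsto_of_complete (Metric.cauchySeq_iff'.2 fun e he => ?_)
    obtain ⟨N, hN⟩ := Metric.cauchySeq_iff'.1 hcau (e ^ 2 / 2) (by positivity)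
    refine ⟨N, fun k hk => ?_⟩
    have h1 := hstep k N hk
    have h2 := hN k hk
    rw [Real.dist_eq] at h2
    have h3 := (abs_lt.1 h2).2
    rw [dist_comm, dist_eq_norm]
    simp only [ha] at h3
    exact lt_of_pow_lt_pow_left₀ 2 he.le (by linarith)
  choose g hg using hlim
  refine ⟨g, measurable_of_tendsto_metrizable (fun k => hmeas _ (by positivity))
    (tendsto_pi_nhds.2 hg), fun x z => ?_⟩
  have h1 : Tendsto (fun k : ℕ => F x (y x (1 / ((k : ℝ) + 1)))) atTop (𝓝 (F x (g x))) :=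
    ((hcont x).tendsto _).comp (hg x)
  have h2 : Tendsto (fun k : ℕ => F x z + 1 / ((k : ℝ) + 1) * ‖z‖ ^ 2) atTop (𝓝 (F x z)) := by
    simpa using (tendsto_one_div_add_atTop_nhds_zero_nat.mul_const (‖z‖ ^ 2)).const_add (F x z)
  refine le_of_tendsto_of_tendsto' h1 h2 fun k => ?_
  have hp : (0 : ℝ) < 1 / ((k : ℝ) + 1) := by positivity
  have := hy x _ hp z
  have h0 : 0 ≤ 1 / ((k : ℝ) + 1) * ‖y x (1 / ((k : ℝ) + 1))‖ ^ 2 := by positivity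
  linarith

/-- Measurable geometric median selectors exist in every dimension and for any number of points. -/
instance (m d : ℕ) : Nonempty (MedianSelector m d) := by
  suffices h : ∃ g : (Fin m → EuclideanSpace ℝ (Fin d)) → EuclideanSpace ℝ (Fin d),
      Measurable g ∧ ∀ v z, ∑ p, ‖g v - v p‖ ≤ ∑ p, ‖z - v p‖ by
    obtain ⟨g, hg, hmin⟩ := h
    exact ⟨⟨g, hg, hmin⟩⟩
  refine exists_measurable_minimizer
    (fun (v : Fin m → EuclideanSpace ℝ (Fin d)) y => ∑ p, ‖y - v p‖) ?_ ?_ ?_ ?_ m ?_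
  · intro v y z
    rw [← Finset.sum_add_distrib, Finset.sum_div]
    refine Finset.sum_le_sum fun p _ => ?_
    have : (1 / 2 : ℝ) • (y + z) - v p = (1 / 2 : ℝ) • ((y - v p) + (z - v p)) := by module
    rw [this, norm_smul, Real.norm_of_nonneg (by norm_num)]
    linarith [norm_add_le (y - v p) (z - v p)]
  · intro v; fun_prop
  · exact fun v y => Finset.sum_nonneg fun _ _ => norm_nonneg _
  · intro v
    rcases Nat.eq_zero_or_pos m with rfl | hm
    · exact ⟨0, by simp⟩
    · refine Continuous.exists_forall_le (by fun_prop) ?_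
      refine tendsto_atTop_mono (f := fun z => ‖z‖ - ‖v ⟨0, hm⟩‖) (fun z => ?_) ?_
      · refine (norm_sub_norm_le _ _).trans ?_
        exact Finset.single_le_sum (f := fun p => ‖z - v p‖) (fun _ _ => norm_nonneg _)
          (Finset.mem_univ _)
      · exact tendsto_atTop_add_const_right _ _ tendsto_norm_cocompact_atTop
  · intro v w y
    rw [← Finset.sum_sub_distrib]
    refine (Finset.abs_sum_le_sum_abs _ _).trans ?_
    have : ∀ p ∈ Finset.univ, |‖y - v p‖ - ‖y - w p‖| ≤ dist v w := fun p _ => by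
      refine (abs_norm_sub_norm_le _ _).trans ?_
      rw [sub_sub_sub_cancel_left, ← dist_eq_norm, dist_comm]
      exact dist_le_pi_dist v w p
    simpa using Finset.sum_le_sum this

/-! ### The mean estimation algorithm -/

/-- The number of blocks, `m = ⌈200 log (1/β)⌉`. -/
def numBlocks (β : ℝ) : ℕ := ⌈200 * Real.log (1 / β)⌉₊

/-- The noise variance `σ² = d c / (2 k² ε)`. -/
def noiseVariance (d k : ℕ) (c ε : ℝ) : ℝ := d * c / (2 * (k : ℝ) ^ 2 * ε)

/-- The average of the rows of the `p`-th block of length `k` (blocks and rows are counted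
from `0`). -/
def blockMean {n d : ℕ} (k : ℕ) (x : Fin n → EuclideanSpace ℝ (Fin d)) (p : ℕ) :
    EuclideanSpace ℝ (Fin d) :=
  (k : ℝ)⁻¹ • ∑ i ∈ Finset.univ.filter (fun i : Fin n => p * k ≤ (i : ℕ) ∧ (i : ℕ) < (p + 1) * k), x i

/-- The law of the noise `(Z_1, …, Z_m)`: i.i.d. with law `N(0, s I_d)`. -/
def noiseLaw (m d : ℕ) (s : ℝ) : Measure (Fin m → EuclideanSpace ℝ (Fin d)) :=
  Measure.pi fun _ => multivariateGaussian 0 (s • (1 : Matrix (Fin d) (Fin d) ℝ))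

instance (m d : ℕ) (s : ℝ) : IsProbabilityMeasure (noiseLaw m d s) := by
  unfold noiseLaw; infer_instance

theorem measurable_noisyMedian {n m d : ℕ} (k : ℕ) (G : MedianSelector m d) :
    Measurable fun q : (Fin n → EuclideanSpace ℝ (Fin d)) × (Fin m → EuclideanSpace ℝ (Fin d)) =>
      G.toFun fun p => blockMean k q.1 p + q.2 p := by
  refine G.measurable.comp (measurable_pi_lambda _ fun p => ?_)
  have h : Measurable fun x : Fin n → EuclideanSpace ℝ (Fin d) => blockMean k x p := by
    unfold blockMean; fun_prop
  exact (h.comp measurable_fst).add ((measurable_pi_apply p).comp measurable_snd)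

/-- The mean estimator as a randomized mechanism: with `m = numBlocks β` and `k = ⌊n / m⌋`, the
database `x` is mapped to the law of `G (blockMean_p x + Z_p)_{p < m}`, where the `Z_p` are
i.i.d. `N(0, σ² I_d)` and `G` selects a geometric median. -/
def meanEstimator {n d : ℕ} (c ε β : ℝ) (G : MedianSelector (numBlocks β) d) :
    Kernel (Fin n → EuclideanSpace ℝ (Fin d)) (EuclideanSpace ℝ (Fin d)) :=
  (Kernel.id ×ₖ Kernel.const _
      (noiseLaw (numBlocks β) d (noiseVariance d (n / numBlocks β) c ε))).map
    fun q => G.toFun fun p => blockMean (n / numBlocks β) q.1 p + q.2 p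

instance {n d : ℕ} (c ε β : ℝ) (G : MedianSelector (numBlocks β) d) :
    IsMarkovKernel (meanEstimator (n := n) c ε β G) :=
  Kernel.IsMarkovKernel.map _ (measurable_noisyMedian _ G)

theorem meanEstimator_apply {n d : ℕ} (c ε β : ℝ) (G : MedianSelector (numBlocks β) d)
    (x : Fin n → EuclideanSpace ℝ (Fin d)) :
    meanEstimator c ε β G x =
      (noiseLaw (numBlocks β) d (noiseVariance d (n / numBlocks β) c ε)).map
        fun z => G.toFun fun p => blockMean (n / numBlocks β) x p + z p := by
  rw [meanEstimator, Kernel.map_apply _ (measurable_noisyMedian _ G), Kernel.prod_apply,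
    Kernel.id_apply, Kernel.const_apply, Measure.dirac_prod,
    Measure.map_map (measurable_noisyMedian _ G) (by fun_prop)]
  rfl

end MIPrivacy

end

/-! Privacy. Fix a row `i` and compare the mechanism with a surrogate that replaces `X_i` by a
constant `e`, keeping the other rows and the noise. The conditional law of the output is the best
kernel from the other rows (`condMutualInfo_le_klDiv`), so the information is at most the divergence
between the true and the surrogate experiment. The true output is the surrogate with its noise
translated by the effect of row `i` on the block means. By data processing, neither the median nor
its tie-breaking matters, and Cameron–Martin (`klDiv_map_shift_le`) bounds the divergence by half
the mean squared translation in units of the noise. A row enters at most one block, with weight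
`1/k`; taking `e` to be its mean gives `c / (2 k² σ²) = ε / d`.

Accuracy. A geometric median is within `4ρ` of any point that has more than two thirds of the data
within `ρ` (`IsGeometricMedian.norm_sub_le`). By Chebyshev, each block mean and each noise vector
exceeds its allowed deviation with probability at most `exp (-12)`. The block means are i.i.d., and
so are the noise vectors, so a Chernoff bound (`pi_card_filter_mem_le`) shows that, up to
probability `2 exp (-m) ≤ β`, fewer than `m/6` of each are bad. -/

namespace MIPrivacy

/-! ### Gaussian shifts and their relative entropy -/

/-- The Cameron–Martin formula for the standard Gaussian on the line. -/
theorem gaussianReal_map_add_eq_withDensity (a : ℝ) :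
    (gaussianReal 0 1).map (fun y => y + a) =
      (gaussianReal 0 1).withDensity
        fun y => ENNReal.ofReal (Real.exp (a * y - a ^ 2 / 2)) := by
  rw [gaussianReal_map_add_const, gaussianReal_of_var_ne_zero _ one_ne_zero,
    gaussianReal_of_var_ne_zero _ one_ne_zero, ← withDensity_mul _ (by fun_prop) (by fun_prop)]
  congr 1
  ext y
  rw [Pi.mul_apply, gaussianPDF, gaussianPDF, ← ENNReal.ofReal_mul (gaussianPDFReal_nonneg _ _ _),
    gaussianPDFReal, gaussianPDFReal, mul_assoc _ (Real.exp _), ← Real.exp_add]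
  congr 3
  simp only [NNReal.coe_one]
  ring

/-- The standard Gaussian measure on `ℝ^ι`. -/
noncomputable def stdGaussianPi (ι : Type*) [Fintype ι] : Measure (ι → ℝ) :=
  Measure.pi fun _ => gaussianReal 0 1

instance (ι : Type*) [Fintype ι] : IsProbabilityMeasure (stdGaussianPi ι) := by
  unfold stdGaussianPi; infer_instance

section Shift

variable {ι : Type*} [Fintype ι]

/-- The log-likelihood ratio of the standard Gaussian shifted by `a` to the standard Gaussian. -/
noncomputable def shiftLogDensity (a y : ι → ℝ) : ℝ := ∑ i, (a i * y i - a i ^ 2 / 2)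

/-- The Cameron–Martin formula in finite dimension. -/
theorem stdGaussianPi_map_add (a : ι → ℝ) :
    (stdGaussianPi ι).map (fun y => y + a) =
      (stdGaussianPi ι).withDensity
        fun y => ENNReal.ofReal (Real.exp (shiftLogDensity a y)) := by
  have h1 : (stdGaussianPi ι).map (fun y => y + a) =
      Measure.pi fun i => (gaussianReal 0 1).map (fun y => y + a i) := by
    have : ∀ i, IsProbabilityMeasure ((gaussianReal 0 1).map (fun y => y + a i)) :=
      fun i => Measure.isProbabilityMeasure_map (by fun_prop)
    rw [stdGaussianPi, ← Measure.pi_map_pi (fun i => by fun_prop)]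
    rfl
  rw [h1]
  have : ∀ i, SigmaFinite ((gaussianReal 0 1).map (fun y => y + a i)) := fun i => by
    have := Measure.isProbabilityMeasure_map (μ := gaussianReal 0 1) (f := fun y => y + a i)
      (by fun_prop)
    infer_instance
  refine Measure.pi_eq fun s hs => ?_
  have hind : iIndepFun (fun i (y : ι → ℝ) =>
      (s i).indicator (fun t => ENNReal.ofReal (Real.exp (a i * t - a i ^ 2 / 2))) (y i))
      (stdGaussianPi ι) :=
    iIndepFun_pi (fun i => (Measurable.indicator (by fun_prop) (hs i)).aemeasurable)
  -- It suffices to compare measures of boxes. On a box both the indicator and the density split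
  -- over coordinates, and independence turns the integral into a product of one-dimensional ones.
  have hprod : ∀ y : ι → ℝ, (Set.univ.pi s).indicator
      (fun y => ENNReal.ofReal (Real.exp (shiftLogDensity a y))) y =
      ∏ i, (s i).indicator (fun t => ENNReal.ofReal (Real.exp (a i * t - a i ^ 2 / 2))) (y i) := by
    intro y
    by_cases hy : y ∈ Set.univ.pi s
    · rw [Set.indicator_of_mem hy, shiftLogDensity, Real.exp_sum,
        ENNReal.ofReal_prod_of_nonneg (fun _ _ => (Real.exp_pos _).le)]
      refine Finset.prod_congr rfl fun i _ => ?_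
      rw [Set.indicator_of_mem (hy i trivial)]
    · rw [Set.indicator_of_notMem hy]
      simp only [Set.mem_pi, Set.mem_univ, true_imp_iff, not_forall] at hy
      obtain ⟨i, hi⟩ := hy
      exact (Finset.prod_eq_zero (Finset.mem_univ i) (Set.indicator_of_notMem hi _)).symm
  rw [withDensity_apply _ (MeasurableSet.univ_pi hs),
    ← lintegral_indicator (MeasurableSet.univ_pi hs)]
  simp_rw [hprod]
  rw [lintegral_prod_eq_prod_lintegral_of_indepFun _ _ hind
    fun i => (Measurable.indicator (by fun_prop) (hs i)).comp (measurable_pi_apply i)]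
  refine Finset.prod_congr rfl fun i _ => ?_
  rw [gaussianReal_map_add_eq_withDensity, withDensity_apply _ (hs i),
    ← lintegral_indicator (hs i)]
  exact (measurePreserving_eval (fun _ : ι => gaussianReal 0 1) i).lintegral_comp
    (Measurable.indicator (by fun_prop) (hs i))

/-- The Kullback–Leibler divergence between a Gaussian vector with a random shift `δ` and one
without shift is at most half the mean square of the shift. -/
theorem klDiv_map_shift_le {X : Type*} [MeasurableSpace X] (μ : Measure X)
    [IsProbabilityMeasure μ] {δ : X → ι → ℝ} (hδ : Measurable δ)
    (hδ2 : ∀ i, MemLp (fun x => δ x i) 2 μ) :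
    InformationTheory.klDiv
      ((μ.prod (stdGaussianPi ι)).map fun q => (q.1, q.2 + δ q.1)) (μ.prod (stdGaussianPi ι)) ≤
      ENNReal.ofReal (∫ x, ∑ i, δ x i ^ 2 / 2 ∂μ) := by
  set π := μ.prod (stdGaussianPi ι) with hπ
  set T : X × (ι → ℝ) → X × (ι → ℝ) := fun q => (q.1, q.2 + δ q.1) with hT
  have hTm : Measurable T := by fun_prop
  set L : X × (ι → ℝ) → ℝ := fun q => shiftLogDensity (δ q.1) q.2 with hL
  have hLm : Measurable L := by
    simp only [hL, shiftLogDensity]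
    fun_prop
  have hfm : Measurable fun q => ENNReal.ofReal (Real.exp (L q)) := by fun_prop
  -- For fixed `x` the shift `δ x` is deterministic, so Cameron–Martin applies on each fibre.
  have hdens : π.map T = π.withDensity fun q => ENNReal.ofReal (Real.exp (L q)) := by
    refine Measure.ext_of_lintegral _ fun g hg => ?_
    rw [lintegral_map hg hTm, lintegral_withDensity_eq_lintegral_mul _ hfm hg, hπ,
      lintegral_prod _ (by fun_prop), lintegral_prod _ (by fun_prop)]
    refine lintegral_congr fun x => ?_
    have := lintegral_map (μ := stdGaussianPi ι) (f := fun y => g (x, y))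
      (g := fun y => y + δ x) (by fun_prop) (by fun_prop)
    simp only [hT]
    rw [← this, stdGaussianPi_map_add,
      lintegral_withDensity_eq_lintegral_mul _ (by unfold shiftLogDensity; fun_prop) (by fun_prop)]
    rfl
  have hac : π.map T ≪ π := by
    rw [hdens]; exact withDensity_absolutelyContinuous _ _
  have hllr : llr (π.map T) π =ᵐ[π.map T] L := by
    refine hac.ae_le ?_
    have h := Measure.rnDeriv_withDensity π hfm
    rw [← hdens] at h
    filter_upwards [h] with q hq
    rw [llr, hq, ENNReal.toReal_ofReal (Real.exp_pos _).le, Real.log_exp]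
  -- Evaluating at the shifted point flips the sign of the quadratic term. The linear term
  -- integrates to zero, the noise being centered and independent of `x`, so only half the mean
  -- square remains.
  have hLT : ∀ q, L (T q) = ∑ i, (δ q.1 i * q.2 i + δ q.1 i ^ 2 / 2) := by
    intro q
    simp only [hL, hT, shiftLogDensity, Pi.add_apply]
    refine Finset.sum_congr rfl fun i _ => by ring
  have hyi : ∀ i, MemLp (fun y : ι → ℝ => y i) 2 (stdGaussianPi ι) := fun i =>
    (memLp_id_gaussianReal 2).comp_measurePreserving
      (measurePreserving_eval (fun _ : ι => gaussianReal 0 1) i)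
  have hint1 : ∀ i, Integrable (fun q : X × (ι → ℝ) => δ q.1 i * q.2 i) π := fun i =>
    ((hδ2 i).integrable one_le_two).mul_prod ((hyi i).integrable one_le_two)
  have hint2 : ∀ i, Integrable (fun x => δ x i ^ 2 / 2) μ := fun i =>
    ((hδ2 i).integrable_sq).div_const 2
  have hint2' : ∀ i, Integrable (fun q : X × (ι → ℝ) => δ q.1 i ^ 2 / 2) π := fun i =>
    (hint2 i).comp_fst _
  have hintLT : Integrable (fun q => L (T q)) π := by
    simp_rw [hLT]
    exact integrable_finsetSum _ fun i _ => (hint1 i).add (hint2' i)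
  have hintL : Integrable L (π.map T) :=
    (integrable_map_measure hLm.aestronglyMeasurable hTm.aemeasurable).2 hintLT
  have : IsProbabilityMeasure (π.map T) := Measure.isProbabilityMeasure_map hTm.aemeasurable
  rw [InformationTheory.klDiv_of_ac_of_integrable hac ((integrable_congr hllr).2 hintL)]
  refine ENNReal.ofReal_le_ofReal (le_of_eq ?_)
  rw [integral_congr_ae hllr, integral_map hTm.aemeasurable hLm.aestronglyMeasurable]
  simp_rw [hLT]
  rw [integral_finsetSum (f := fun i (q : X × (ι → ℝ)) => δ q.1 i * q.2 i + δ q.1 i ^ 2 / 2) _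
      fun i _ => (hint1 i).add (hint2' i),
    integral_finsetSum _ fun i _ => hint2 i]
  simp only [probReal_univ, add_sub_cancel_right]
  refine Finset.sum_congr rfl fun i _ => ?_
  rw [integral_add (hint1 i) (hint2' i), hπ, integral_prod_mul (fun x => δ x i) (fun y : ι → ℝ => y i),
    integral_fun_fst (fun x => δ x i ^ 2 / 2)]
  have h0 : ∫ y, y i ∂(stdGaussianPi ι) = 0 := by
    simp [stdGaussianPi, integral_eval]
  simp [h0]

end Shift

/-! ### Isotropic noise in standard coordinates -/

/-- The centered isotropic Gaussian law is a scaling of the standard one. -/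
theorem multivariateGaussian_smul_one (d : ℕ) {s : ℝ} (hs : 0 ≤ s) :
    multivariateGaussian 0 (s • (1 : Matrix (Fin d) (Fin d) ℝ)) =
      (Measure.pi fun _ : Fin d => gaussianReal 0 1).map fun y => √s • WithLp.toLp 2 y := by
  have h : (Measure.pi fun _ : Fin d => gaussianReal 0 1).map (fun y => √s • WithLp.toLp 2 y) =
      (stdGaussian (EuclideanSpace ℝ (Fin d))).map fun z => √s • z := by
    rw [← map_pi_eq_stdGaussian, Measure.map_map (by fun_prop) (by fun_prop)]
    rfl
  rw [h]
  refine Measure.ext_of_charFun ?_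
  ext t
  rw [charFun_multivariateGaussian (Matrix.PosSemidef.one.smul hs), charFun_map_smul,
    charFun_stdGaussian, norm_smul, ← Complex.ofReal_pow, mul_pow, Real.norm_of_nonneg (Real.sqrt_nonneg _),
    Real.sq_sqrt hs, EuclideanSpace.real_norm_sq_eq]
  simp only [inner_zero_right, Complex.ofReal_zero, zero_mul, zero_sub, Matrix.smul_mulVec,
    Matrix.one_mulVec, dotProduct_smul, smul_eq_mul]
  simp only [dotProduct, ← pow_two]
  push_cast
  ring_nf

/-- The noise vectors as a scaling of a standard Gaussian family indexed by block and coordinate. -/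
theorem noiseLaw_eq_map (m d : ℕ) {s : ℝ} (hs : 0 ≤ s) :
    noiseLaw m d s = (stdGaussianPi (Fin m × Fin d)).map
      fun y p => √s • WithLp.toLp 2 fun j => y (p, j) := by
  have h1 : (stdGaussianPi (Fin m × Fin d)).map (MeasurableEquiv.curry (Fin m) (Fin d) ℝ) =
      Measure.pi fun _ : Fin m => Measure.pi fun _ : Fin d => gaussianReal 0 1 := by
    have := Measure.infinitePi_map_curry
      (fun (_ : Fin m) (_ : Fin d) => gaussianReal 0 1)
    simpa only [stdGaussianPi, Measure.infinitePi_eq_pi] using this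
  have h2 : (fun (y : Fin m × Fin d → ℝ) (p : Fin m) =>
      √s • WithLp.toLp 2 fun j => y (p, j)) =
      (fun (w : Fin m → Fin d → ℝ) p => √s • WithLp.toLp 2 (w p)) ∘
        MeasurableEquiv.curry (Fin m) (Fin d) ℝ := rfl
  have : IsProbabilityMeasure
      ((Measure.pi fun _ : Fin d => gaussianReal 0 1).map fun y => √s • WithLp.toLp 2 y) :=
    Measure.isProbabilityMeasure_map (by fun_prop)
  rw [h2, ← Measure.map_map (by fun_prop) (MeasurableEquiv.measurable _), h1, noiseLaw,
    multivariateGaussian_smul_one d hs]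
  exact (Measure.pi_map_pi (f := fun (_ : Fin m) (y : Fin d → ℝ) => √s • WithLp.toLp 2 y)
    fun _ => by fun_prop).symm

/-! ### Variational bound for conditional mutual information -/

section Information

variable {Ω 𝓤 𝓥 𝓦 : Type*} [MeasurableSpace Ω]
  [MeasurableSpace 𝓤] [MeasurableSpace 𝓥] [MeasurableSpace 𝓦]

/-- Moving the `𝓤`-coordinate to the end exposes a kernel that ignores `𝓥`, the form on which the
chain rule for the divergence acts. -/
theorem map_compProd_prod_swap (μ : Measure 𝓦) [IsProbabilityMeasure μ] (A : Kernel 𝓦 𝓤)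
    [IsMarkovKernel A] (Q : Kernel 𝓦 𝓥) [IsMarkovKernel Q] :
    (μ ⊗ₘ (A ×ₖ Q)).map (fun t => ((t.1, t.2.2), t.2.1)) =
      (μ ⊗ₘ Q) ⊗ₘ Kernel.prodMkRight 𝓥 A := by
  refine Measure.ext_of_lintegral _ fun g hg => ?_
  rw [lintegral_map hg (by fun_prop), Measure.lintegral_compProd (by fun_prop),
    Measure.lintegral_compProd hg, Measure.lintegral_compProd
      (f := fun p => ∫⁻ b, g (p, b) ∂Kernel.prodMkRight 𝓥 A p)
      (by exact Measurable.lintegral_kernel_prod_right' hg)]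
  refine lintegral_congr fun w => ?_
  rw [Kernel.prod_apply, lintegral_prod_symm' _ (by fun_prop)]
  rfl

variable [StandardBorelSpace 𝓤] [Nonempty 𝓤] [StandardBorelSpace 𝓥] [Nonempty 𝓥]

/-- The conditional law `P_{V|W}` minimizes the divergence of `P_{W,U,V}` from
`P_W ⊗ (P_{U|W} × Q)` over all kernels `Q`. -/
theorem condMutualInfo_le_klDiv (P : Measure Ω) [IsProbabilityMeasure P] {U : Ω → 𝓤} {V : Ω → 𝓥}
    {W : Ω → 𝓦} (hU : Measurable U) (hV : Measurable V) (hW : Measurable W)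
    (Q : Kernel 𝓦 𝓥) [IsMarkovKernel Q] :
    condMutualInfo P U V W ≤ InformationTheory.klDiv (P.map fun ω => (W ω, U ω, V ω))
      ((P.map W) ⊗ₘ (condDistrib U W P ×ₖ Q)) := by
  have : IsProbabilityMeasure (P.map W) := Measure.isProbabilityMeasure_map hW.aemeasurable
  have hPWV : IsProbabilityMeasure (P.map fun ω => (W ω, V ω)) :=
    Measure.isProbabilityMeasure_map (by fun_prop)
  have : IsProbabilityMeasure (P.map fun ω => (W ω, U ω, V ω)) :=
    Measure.isProbabilityMeasure_map (by fun_prop)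
  set e : 𝓦 × 𝓤 × 𝓥 → (𝓦 × 𝓥) × 𝓤 := fun t => ((t.1, t.2.2), t.2.1) with he
  set e' : (𝓦 × 𝓥) × 𝓤 → 𝓦 × 𝓤 × 𝓥 := fun t => (t.1.1, t.2, t.1.2) with he'
  have hem : Measurable e := by fun_prop
  have hem' : Measurable e' := by fun_prop
  have hjoint : (P.map fun ω => (W ω, U ω, V ω)).map e =
      (P.map fun ω => (W ω, V ω)) ⊗ₘ condDistrib U (fun ω => (W ω, V ω)) P := by
    rw [compProd_map_condDistrib hU.aemeasurable, Measure.map_map hem (by fun_prop)]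
    rfl
  -- Since `e'` undoes `e`, data processing in either direction makes the reordering harmless.
  have hback : ∀ μ : Measure (𝓦 × 𝓤 × 𝓥), (μ.map e).map e' = μ := fun μ => by
    rw [Measure.map_map hem' hem]
    exact Measure.map_id
  calc condMutualInfo P U V W
      = InformationTheory.klDiv (((P.map fun ω => (W ω, U ω, V ω)).map e).map e')
        ((((P.map W) ⊗ₘ (condDistrib U W P ×ₖ condDistrib V W P)).map e).map e') := by
        rw [hback, hback, condMutualInfo]
    _ ≤ InformationTheory.klDiv ((P.map fun ω => (W ω, U ω, V ω)).map e)
        (((P.map W) ⊗ₘ (condDistrib U W P ×ₖ condDistrib V W P)).map e) := by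
        have h1 : IsProbabilityMeasure ((P.map fun ω => (W ω, U ω, V ω)).map e) :=
          Measure.isProbabilityMeasure_map hem.aemeasurable
        have h2 : IsProbabilityMeasure
            (((P.map W) ⊗ₘ (condDistrib U W P ×ₖ condDistrib V W P)).map e) :=
          Measure.isProbabilityMeasure_map hem.aemeasurable
        exact InformationTheory.klDiv_map_le _ _ hem'
    _ ≤ InformationTheory.klDiv ((P.map fun ω => (W ω, U ω, V ω)).map e)
        (((P.map W) ⊗ₘ (condDistrib U W P ×ₖ Q)).map e) := by
        -- By the chain rule the divergence relative to `Q` is that of `P_{W,V}` from `P_W ⊗ Q` plus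
        -- a second term; this second term is exactly the divergence relative to `P_{V|W}`.
        rw [hjoint, map_compProd_prod_swap, map_compProd_prod_swap,
          compProd_map_condDistrib hV.aemeasurable,
          InformationTheory.klDiv_compProd_eq_add (P.map fun ω => (W ω, V ω)) ((P.map W) ⊗ₘ Q)]
        exact le_add_self
    _ ≤ _ := InformationTheory.klDiv_map_le _ _ hem

end Information

section Mechanism

variable {X Z 𝓤 𝓥 𝓦 : Type*} [MeasurableSpace X] [MeasurableSpace Z]
  [MeasurableSpace 𝓤] [StandardBorelSpace 𝓤] [Nonempty 𝓤]
  [MeasurableSpace 𝓥] [StandardBorelSpace 𝓥] [Nonempty 𝓥] [MeasurableSpace 𝓦]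

/-- For a mechanism of the form `x ↦ f (x, Z)` with `Z ∼ γ`, the conditional mutual information
between `U` and the output given `W` is at most the divergence from any surrogate output
`h (W, Z)` that does not use `U`. -/
theorem condMutualInfo_compProd_le (μ : Measure X) [IsProbabilityMeasure μ] (γ : Measure Z)
    [IsProbabilityMeasure γ] (M : Kernel X 𝓥) [IsMarkovKernel M] {f : X × Z → 𝓥}
    (hf : Measurable f) (hM : ∀ x, M x = γ.map fun z => f (x, z)) {U : X → 𝓤} {W : X → 𝓦}
    (hU : Measurable U) (hW : Measurable W) {h : 𝓦 × Z → 𝓥} (hh : Measurable h) :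
    condMutualInfo (μ ⊗ₘ M) (fun q => U q.1) (fun q => q.2) (fun q => W q.1) ≤
      InformationTheory.klDiv ((μ.prod γ).map fun q => (W q.1, U q.1, f q))
        ((μ.prod γ).map fun q => (W q.1, U q.1, h (W q.1, q.2))) := by
  set Q : Kernel 𝓦 𝓥 := (Kernel.id ×ₖ Kernel.const 𝓦 γ).map h with hQ
  have : IsMarkovKernel Q := Kernel.IsMarkovKernel.map _ hh
  have hQw : ∀ w, Q w = γ.map fun z => h (w, z) := fun w => by
    rw [hQ, Kernel.map_apply _ hh, Kernel.prod_apply, Kernel.id_apply, Kernel.const_apply,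
      Measure.dirac_prod, Measure.map_map hh (by fun_prop)]
    rfl
  refine (condMutualInfo_le_klDiv (μ ⊗ₘ M) (U := fun q => U q.1)
    (W := fun q => W q.1) (hU.comp measurable_fst) measurable_snd
    (hW.comp measurable_fst) Q).trans (le_of_eq ?_)
  have : IsProbabilityMeasure ((μ ⊗ₘ M).map fun q => W q.1) :=
    Measure.isProbabilityMeasure_map (hW.comp measurable_fst).aemeasurable
  congr 1
  · refine Measure.ext_of_lintegral _ fun g hg => ?_
    rw [lintegral_map hg (by fun_prop), lintegral_map hg (by fun_prop),
      Measure.lintegral_compProd (by fun_prop), lintegral_prod _ (by fun_prop)]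
    refine lintegral_congr fun x => ?_
    rw [hM, lintegral_map (by fun_prop) (by fun_prop)]
  · refine Measure.ext_of_lintegral _ fun g hg => ?_
    have hg2 : Measurable fun p : 𝓦 × 𝓤 => ∫⁻ z, g (p.1, p.2, h (p.1, z)) ∂γ :=
      Measurable.lintegral_prod_right' (f := fun r : (𝓦 × 𝓤) × Z =>
        g (r.1.1, r.1.2, h (r.1.1, r.2))) (by fun_prop)
    have hleft : ∫⁻ t, g t ∂(((μ ⊗ₘ M).map fun q => W q.1) ⊗ₘ
        (condDistrib (fun q => U q.1) (fun q => W q.1) (μ ⊗ₘ M) ×ₖ Q)) =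
        ∫⁻ p, ∫⁻ z, g (p.1, p.2, h (p.1, z)) ∂γ
          ∂(((μ ⊗ₘ M).map fun q => W q.1) ⊗ₘ
            condDistrib (fun q => U q.1) (fun q => W q.1) (μ ⊗ₘ M)) := by
      rw [Measure.lintegral_compProd hg, Measure.lintegral_compProd hg2]
      refine lintegral_congr fun w => ?_
      rw [Kernel.prod_apply, lintegral_prod _ (by fun_prop)]
      refine lintegral_congr fun u => ?_
      rw [hQw, lintegral_map (by fun_prop) (by fun_prop)]
    -- Gluing `P_{U|W}` back to `P_W` restores the joint law of `(W, U)`, independent of the noise.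
    rw [hleft, compProd_map_condDistrib (Y := fun q : X × 𝓥 => U q.1)
        (hU.comp measurable_fst).aemeasurable,
      lintegral_map hg2 (by fun_prop), lintegral_map hg (by fun_prop),
      lintegral_prod _ (by fun_prop), Measure.lintegral_compProd
        (f := fun a => ∫⁻ z, g (W a.1, U a.1, h (W a.1, z)) ∂γ)
        (hg2.comp (by fun_prop : Measurable fun q : X × 𝓥 => (W q.1, U q.1)))]
    simp

end Mechanism

/-! ### Row sensitivity and privacy -/

/-- The database obtained from the rows other than `i` by inserting `e` as the `i`-th row. -/
def insertRow {n : ℕ} {E : Type*} (i : Fin n) (e : E) (w : {j : Fin n // j ≠ i} → E) :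
    Fin n → E :=
  fun j => if h : j = i then e else w ⟨j, h⟩

theorem measurable_insertRow {n : ℕ} {E : Type*} [MeasurableSpace E] (i : Fin n) (e : E) :
    Measurable (insertRow i e) := by
  refine measurable_pi_lambda _ fun j => ?_
  unfold insertRow
  split_ifs with h
  · exact measurable_const
  · exact measurable_pi_apply _

theorem insertRow_restrict {n : ℕ} {E : Type*} (i : Fin n) (e : E) (x : Fin n → E) :
    insertRow i e (fun j : {j : Fin n // j ≠ i} => x j) = Function.update x i e := by
  ext j
  by_cases h : j = i
  · subst h; simp [insertRow]
  · simp [insertRow, h]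

section Privacy

variable {n d : ℕ}

/-- Changing one row only affects the mean of the block that contains it. -/
theorem blockMean_sub_blockMean_update (k : ℕ) (x : Fin n → EuclideanSpace ℝ (Fin d)) (i : Fin n)
    (e : EuclideanSpace ℝ (Fin d)) (p : ℕ) :
    blockMean k x p - blockMean k (Function.update x i e) p =
      if p * k ≤ (i : ℕ) ∧ (i : ℕ) < (p + 1) * k then (k : ℝ)⁻¹ • (x i - e) else 0 := by
  rw [blockMean, blockMean, ← smul_sub, ← Finset.sum_sub_distrib]
  have h : ∀ j, x j - Function.update x i e j = if j = i then x i - e else 0 := fun j => by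
    by_cases hj : j = i
    · subst hj; simp
    · simp [hj]
  simp_rw [h, Finset.sum_ite_eq', Finset.mem_filter_univ]
  split_ifs <;> simp

/-- Row `i` can only lie in block `i / k`, where its weight is `1/k`; if `i / k ≥ m` it is a
leftover row and the sum vanishes. -/
theorem sum_norm_blockMean_sub_sq_le (m k : ℕ) (x : Fin n → EuclideanSpace ℝ (Fin d))
    (i : Fin n) (e : EuclideanSpace ℝ (Fin d)) :
    ∑ p : Fin m, ‖blockMean k x p - blockMean k (Function.update x i e) p‖ ^ 2 ≤
      ‖x i - e‖ ^ 2 / (k : ℝ) ^ 2 := by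
  have h : ∀ p : Fin m, ‖blockMean k x p - blockMean k (Function.update x i e) p‖ ^ 2 ≤
      if (p : ℕ) = i / k then ‖x i - e‖ ^ 2 / (k : ℝ) ^ 2 else 0 := by
    intro p
    rw [blockMean_sub_blockMean_update]
    split_ifs with h1 h2 h2
    · rw [norm_smul, mul_pow, norm_inv, Real.norm_natCast, inv_pow, inv_mul_eq_div]
    · exact absurd (Nat.div_eq_of_lt_le h1.1 h1.2).symm h2
    · simp only [norm_zero, ne_eq, OfNat.ofNat_ne_zero, not_false_eq_true, zero_pow]
      positivity
    · simp
  refine (Finset.sum_le_sum fun p _ => h p).trans ?_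
  by_cases hi : (i : ℕ) / k < m
  · rw [Finset.sum_eq_single (⟨i / k, hi⟩ : Fin m)]
    · simp
    · intro p _ hp
      rw [if_neg fun h => hp (Fin.ext h)]
    · simp
  · rw [Finset.sum_eq_zero fun (p : Fin m) _ => if_neg fun h => hi (lt_of_eq_of_lt h.symm p.2)]
    positivity

/-- A geometric median of noisy block means reveals little about a row with small variance. -/
theorem condMutualInfo_noisyMedian_le {m k : ℕ} {s : ℝ} (hs : 0 < s)
    (G : MedianSelector m d) (M : Kernel (Fin n → EuclideanSpace ℝ (Fin d))
      (EuclideanSpace ℝ (Fin d))) [IsMarkovKernel M]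
    (hMx : ∀ x, M x = (noiseLaw m d s).map fun z => G.toFun fun p => blockMean k x p + z p)
    (μ : Measure (Fin n → EuclideanSpace ℝ (Fin d))) [IsProbabilityMeasure μ] (i : Fin n)
    (hL2 : MemLp (fun x => x i) 2 μ) (e : EuclideanSpace ℝ (Fin d)) :
    condMutualInfo (μ ⊗ₘ M)
      (fun q => q.1 i) (fun q => q.2) (fun q => fun j : {j : Fin n // j ≠ i} => q.1 j)
      ≤ ENNReal.ofReal ((2 * s * (k : ℝ) ^ 2)⁻¹ * ∫ x, ‖x i - e‖ ^ 2 ∂μ) := by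
  set γ := stdGaussianPi (Fin m × Fin d) with hγ
  set f : (Fin n → EuclideanSpace ℝ (Fin d)) × (Fin m × Fin d → ℝ) → EuclideanSpace ℝ (Fin d) :=
    fun q => G.toFun fun p => blockMean k q.1 p + √s • WithLp.toLp 2 fun j => q.2 (p, j) with hf
  have hfm : Measurable f :=
      (measurable_noisyMedian k G).comp (f := fun q : (Fin n → EuclideanSpace ℝ (Fin d)) ×
      (Fin m × Fin d → ℝ) => (q.1, fun p => √s • WithLp.toLp 2 fun j => q.2 (p, j)))
      (by fun_prop)
  have hM : ∀ x, M x = γ.map fun z => f (x, z) := by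
    intro x
    have hg : Measurable fun z : Fin m → EuclideanSpace ℝ (Fin d) =>
        G.toFun fun p => blockMean k x p + z p := G.measurable.comp (by fun_prop)
    rw [hMx, noiseLaw_eq_map _ _ hs.le, Measure.map_map hg (by fun_prop)]
    rfl
  set h : ({j : Fin n // j ≠ i} → EuclideanSpace ℝ (Fin d)) × (Fin m × Fin d → ℝ) →
    EuclideanSpace ℝ (Fin d) := fun q => f (insertRow i e q.1, q.2) with hh
  have hhm : Measurable h :=
    hfm.comp (((measurable_insertRow i e).comp measurable_fst).prodMk measurable_snd)
  set W : (Fin n → EuclideanSpace ℝ (Fin d)) → {j : Fin n // j ≠ i} → EuclideanSpace ℝ (Fin d) :=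
    fun x j => x j with hW
  have hWm : Measurable W := by fun_prop
  refine (condMutualInfo_compProd_le μ γ M hfm hM
    (U := fun x => x i) (W := W) (by fun_prop) hWm hhm).trans ?_
  -- The displacement of the block means, measured in noise standard deviations: translating the
  -- standard noise by it turns the surrogate output into the true one.
  set δ : (Fin n → EuclideanSpace ℝ (Fin d)) → Fin m × Fin d → ℝ := fun x r =>
    (√s)⁻¹ * (blockMean k x r.1 - blockMean k (Function.update x i e) r.1) r.2 with hδ
  have hδeq : ∀ (r : Fin m × Fin d) x, δ x r =
      (if (r.1 : ℕ) * k ≤ (i : ℕ) ∧ (i : ℕ) < ((r.1 : ℕ) + 1) * k then (√s)⁻¹ * (k : ℝ)⁻¹ else 0) *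
        (x i - e) r.2 := by
    intro r x
    simp only [hδ, blockMean_sub_blockMean_update]
    split_ifs <;> simp [mul_assoc]
  have hδm : Measurable δ := by
    refine measurable_pi_lambda _ fun r => ?_
    simp_rw [hδeq]
    fun_prop
  have hδ2 : ∀ r, MemLp (fun x => δ x r) 2 μ := by
    intro r
    simp_rw [hδeq]
    refine MemLp.const_mul ?_ _
    have h1 : MemLp (fun x : Fin n → EuclideanSpace ℝ (Fin d) => x i - e) 2 μ :=
      hL2.sub (memLp_const e)
    exact (EuclideanSpace.proj (𝕜 := ℝ) r.2).comp_memLp' h1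
  have hsqrt : √s ≠ 0 := (Real.sqrt_pos.2 hs).ne'
  have hshift : ∀ q : (Fin n → EuclideanSpace ℝ (Fin d)) × (Fin m × Fin d → ℝ),
      f q = h (W q.1, q.2 + δ q.1) := by
    intro q
    simp only [hh, hW, insertRow_restrict, hf]
    congr 1
    ext p j
    simp [hδ, mul_add, mul_inv_cancel_left₀ hsqrt]
    ring
  set T : (Fin n → EuclideanSpace ℝ (Fin d)) × (Fin m × Fin d → ℝ) →
    ({j : Fin n // j ≠ i} → EuclideanSpace ℝ (Fin d)) × EuclideanSpace ℝ (Fin d) ×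
      EuclideanSpace ℝ (Fin d) := fun q => (W q.1, q.1 i, h (W q.1, q.2)) with hT
  have hTm : Measurable T := by fun_prop
  have hmap : (μ.prod γ).map (fun q => (W q.1, q.1 i, f q)) =
      ((μ.prod γ).map fun q => (q.1, q.2 + δ q.1)).map T := by
    rw [Measure.map_map hTm (by fun_prop)]
    simp_rw [hshift]
    rfl
  have : IsProbabilityMeasure ((μ.prod γ).map fun q => (q.1, q.2 + δ q.1)) :=
    Measure.isProbabilityMeasure_map (by fun_prop)
  rw [hmap]
  -- Both laws are images under the same `T`, with and without the shift, so the median disappears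
  -- by data processing.
  refine (InformationTheory.klDiv_map_le _ _ hTm).trans
    ((klDiv_map_shift_le μ hδm hδ2).trans (ENNReal.ofReal_le_ofReal ?_))
  have hpt : ∀ x, ∑ r, δ x r ^ 2 / 2 ≤ (2 * s * (k : ℝ) ^ 2)⁻¹ * ‖x i - e‖ ^ 2 := by
    intro x
    have h1 : ∑ r, δ x r ^ 2 / 2 = (2 * s)⁻¹ *
        ∑ p : Fin m, ‖blockMean k x p - blockMean k (Function.update x i e) p‖ ^ 2 := by
      rw [Fintype.sum_prod_type, Finset.mul_sum]
      refine Finset.sum_congr rfl fun p _ => ?_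
      rw [EuclideanSpace.real_norm_sq_eq, Finset.mul_sum]
      refine Finset.sum_congr rfl fun j _ => ?_
      simp only [hδ]
      rw [mul_pow, inv_pow, Real.sq_sqrt hs.le]
      field_simp
    rw [h1]
    refine (mul_le_mul_of_nonneg_left (sum_norm_blockMean_sub_sq_le m k x i e)
      (by positivity)).trans (le_of_eq ?_)
    field_simp
  calc ∫ x, ∑ r, δ x r ^ 2 / 2 ∂μ
      ≤ ∫ x, (2 * s * (k : ℝ) ^ 2)⁻¹ * ‖x i - e‖ ^ 2 ∂μ :=
        integral_mono (integrable_finsetSum _ fun r _ => (hδ2 r).integrable_sq.div_const 2)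
          ((hL2.sub (memLp_const e)).integrable_norm_pow (by norm_num) |>.const_mul _) hpt
    _ = (2 * s * (k : ℝ) ^ 2)⁻¹ * ∫ x, ‖x i - e‖ ^ 2 ∂μ := integral_const_mul _ _

/-- The mutual information privacy of the mean estimator. -/
theorem isMIDP_meanEstimator {c ε β : ℝ} (hd : 1 ≤ d) (hc : 0 < c) (hε : 0 < ε)
    (hk : 0 < n / numBlocks β) (G : MedianSelector (numBlocks β) d) :
    IsMIDP (meanEstimator (n := n) c ε β G) ε (secondMomentClass n d c) := by
  refine iSup₂_le fun P hP => iSup_le fun i => ?_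
  obtain ⟨hL2, hvar⟩ := hP i
  have hk' : (0 : ℝ) < (n / numBlocks β : ℕ) := by exact_mod_cast hk
  have hd' : (1 : ℝ) ≤ d := by exact_mod_cast hd
  have hs : 0 < noiseVariance d (n / numBlocks β) c ε := by
    rw [noiseVariance]; positivity
  -- Unification with `hvar` makes the inserted row the mean of row `i`.
  refine (condMutualInfo_noisyMedian_le hs G _ (meanEstimator_apply c ε β G) _ i hL2 _).trans
    (ENNReal.ofReal_le_ofReal ((mul_le_mul_of_nonneg_left hvar (by positivity)).trans ?_))
  calc _ = ε / d := by
        rw [noiseVariance]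
        field_simp
    _ ≤ ε := div_le_self hε.le hd'

end Privacy

/-! ### Robustness of the median and a Chernoff bound -/

/-- A geometric median is close to any point which is close to at least two thirds of the data. -/
theorem IsGeometricMedian.norm_sub_le {m d : ℕ} {v : Fin m → EuclideanSpace ℝ (Fin d)}
    {y : EuclideanSpace ℝ (Fin d)} (hy : IsGeometricMedian v y) (a : EuclideanSpace ℝ (Fin d))
    {r : ℝ} (hb : 3 * (Finset.univ.filter fun p => r < ‖v p - a‖).card < m) :
    ‖y - a‖ ≤ 4 * r := by
  classical
  set B := Finset.univ.filter fun p => r < ‖v p - a‖ with hB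
  set A := Finset.univ.filter fun p => ¬ r < ‖v p - a‖ with hA
  have hcard : B.card + A.card = m := by
    rw [hB, hA, Finset.card_filter_add_card_filter_not]; simp
  have hsum : ∑ p, (‖y - v p‖ - ‖a - v p‖) ≤ 0 := by
    rw [Finset.sum_sub_distrib]; linarith [hy a]
  -- Moving from `a` to `y` gains at most `‖y - a‖` at each far point and costs at least `‖y - a‖ -
  -- 2r` at each near one. As near points are at least twice as many, minimality forces `‖y - a‖ ≤
  -- 4r`.
  have hBle : (B.card : ℝ) * (-‖y - a‖) ≤ ∑ p ∈ B, (‖y - v p‖ - ‖a - v p‖) := by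
    rw [← nsmul_eq_mul]
    refine Finset.card_nsmul_le_sum _ _ _ fun p _ => ?_
    have := norm_sub_le_norm_sub_add_norm_sub a y (v p)
    rw [norm_sub_rev a y] at this
    linarith
  have hAle : (A.card : ℝ) * (‖y - a‖ - 2 * r) ≤ ∑ p ∈ A, (‖y - v p‖ - ‖a - v p‖) := by
    rw [← nsmul_eq_mul]
    refine Finset.card_nsmul_le_sum _ _ _ fun p hp => ?_
    have h1 : ‖v p - a‖ ≤ r := not_lt.1 (Finset.mem_filter.1 hp).2
    have h2 := norm_sub_le_norm_sub_add_norm_sub y (v p) a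
    rw [norm_sub_rev a (v p)]
    linarith
  rw [← Finset.sum_filter_add_sum_filter_not _ (fun p => r < ‖v p - a‖)] at hsum
  have hle : (2 : ℝ) * B.card ≤ A.card := by exact_mod_cast (by omega)
  have hpos : (0 : ℝ) < A.card := by exact_mod_cast (by omega)
  have hD : (2 : ℝ) * B.card * ‖y - a‖ ≤ A.card * ‖y - a‖ :=
    mul_le_mul_of_nonneg_right hle (norm_nonneg _)
  refine le_of_mul_le_mul_left ?_ hpos
  nlinarith

/-- A Chernoff bound for the number of independent points that fall into an unlikely set. -/
theorem pi_card_filter_mem_le {Y : Type*} [MeasurableSpace Y] (Q : Measure Y)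
    [IsProbabilityMeasure Q] (m : ℕ) {A : Set Y} [DecidablePred (· ∈ A)] (hA : MeasurableSet A)
    (hQ : Q A ≤ ENNReal.ofReal (Real.exp (-12))) :
    (Measure.pi fun _ : Fin m => Q)
      {y | m ≤ 6 * (Finset.univ.filter fun p => y p ∈ A).card} ≤
      ENNReal.ofReal (Real.exp (-m)) := by
  -- `w` dominates `exp (12 · 1_A)` and has mean at most `1 + 1 ≤ e`. With at least `m/6` hits the
  -- product is at least `exp (2m)`, while its mean is at most `exp m`; Markov gives `exp (-m)`.
  set w : Y → ℝ≥0∞ := fun y => 1 + A.indicator (fun _ => ENNReal.ofReal (Real.exp 12)) y with hw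
  have hwm : Measurable w := by
    have : Measurable (A.indicator fun _ => ENNReal.ofReal (Real.exp 12)) :=
      measurable_const.indicator hA
    fun_prop
  have hint : ∫⁻ y, w y ∂Q ≤ ENNReal.ofReal (Real.exp 1) := by
    rw [hw, lintegral_add_left measurable_const, lintegral_indicator_const hA]
    calc ∫⁻ _, 1 ∂Q + ENNReal.ofReal (Real.exp 12) * Q A
        ≤ 1 + ENNReal.ofReal (Real.exp 12) * ENNReal.ofReal (Real.exp (-12)) := by
          gcongr; simp
      _ = ENNReal.ofReal 2 := by
          rw [← ENNReal.ofReal_mul (Real.exp_pos _).le, ← Real.exp_add]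
          norm_num
      _ ≤ _ := ENNReal.ofReal_le_ofReal (by have := Real.add_one_le_exp 1; linarith)
  have hind : iIndepFun (fun (p : Fin m) (y : Fin m → Y) => w (y p)) (Measure.pi fun _ => Q) :=
    iIndepFun_pi fun _ => hwm.aemeasurable
  have hprod : ∫⁻ y, ∏ p, w (y p) ∂(Measure.pi fun _ : Fin m => Q) ≤
      ENNReal.ofReal (Real.exp m) := by
    rw [lintegral_prod_eq_prod_lintegral_of_indepFun _ _ hind
      fun p => hwm.comp (measurable_pi_apply p)]
    calc _ = ∏ _p : Fin m, ∫⁻ y, w y ∂Q := Finset.prod_congr rfl fun p _ =>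
          (measurePreserving_eval (fun _ : Fin m => Q) p).lintegral_comp hwm
      _ ≤ ∏ _p : Fin m, ENNReal.ofReal (Real.exp 1) := Finset.prod_le_prod' fun _ _ => hint
      _ = _ := by
          rw [Finset.prod_const, Finset.card_univ, Fintype.card_fin,
            ← ENNReal.ofReal_pow (Real.exp_pos _).le, ← Real.exp_nat_mul, mul_one]
  have hsub : {y : Fin m → Y | m ≤ 6 * (Finset.univ.filter fun p => y p ∈ A).card} ⊆
      {y | ENNReal.ofReal (Real.exp (2 * m)) ≤ ∏ p, w (y p)} := by
    intro y hy
    simp only [Set.mem_ofPred_eq] at hy ⊢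
    have hy' : (m : ℝ) ≤ 6 * ((Finset.univ.filter fun p => y p ∈ A).card : ℝ) := by
      exact_mod_cast hy
    calc ENNReal.ofReal (Real.exp (2 * m))
        ≤ ENNReal.ofReal (Real.exp 12) ^ (Finset.univ.filter fun p => y p ∈ A).card := by
          rw [← ENNReal.ofReal_pow (Real.exp_pos _).le, ← Real.exp_nat_mul]
          exact ENNReal.ofReal_le_ofReal (Real.exp_le_exp.2 (by linarith))
      _ = ∏ p, if y p ∈ A then ENNReal.ofReal (Real.exp 12) else 1 := by
          rw [Finset.prod_ite, Finset.prod_const, Finset.prod_const_one, mul_one]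
      _ ≤ ∏ p, w (y p) := by
          refine Finset.prod_le_prod' fun p _ => ?_
          split_ifs with h
          · rw [hw]
            simp only [Set.indicator_of_mem h]
            exact le_add_self
          · exact le_self_add
  refine (measure_mono hsub).trans ?_
  have hmarkov := mul_meas_ge_le_lintegral (μ := Measure.pi fun _ : Fin m => Q)
    (f := fun y => ∏ p, w (y p))
    (by fun_prop) (ENNReal.ofReal (Real.exp (2 * m)))
  have hexp : ENNReal.ofReal (Real.exp (2 * m)) * ENNReal.ofReal (Real.exp (-m)) =
      ENNReal.ofReal (Real.exp m) := by
    rw [← ENNReal.ofReal_mul (Real.exp_pos _).le, ← Real.exp_add]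
    ring_nf
  refine (ENNReal.mul_le_mul_iff_right (ENNReal.ofReal_pos.2 (Real.exp_pos (2 * m))).ne'
    ENNReal.ofReal_ne_top).1 ?_
  rw [hexp]
  exact hmarkov.trans hprod

/-! ### Second moments of block means and noise -/

/-- Chebyshev's inequality for the norm. -/
theorem measure_lt_norm_le {Ω E : Type*} [MeasurableSpace Ω] [NormedAddCommGroup E]
    (P : Measure Ω) [IsFiniteMeasure P] {f : Ω → E} (hf : MemLp f 2 P) {r b : ℝ} (hr : 0 < r)
    (hb : ∫ ω, ‖f ω‖ ^ 2 ∂P ≤ b) :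
    P {ω | r < ‖f ω‖} ≤ ENNReal.ofReal (b / r ^ 2) := by
  have h := mul_meas_ge_le_integral_of_nonneg (μ := P) (f := fun ω => ‖f ω‖ ^ 2)
    (ae_of_all _ fun ω => by positivity) (hf.integrable_norm_pow (by norm_num)) (r ^ 2)
  have h2 : P.real {ω | r < ‖f ω‖} ≤ b / r ^ 2 := by
    rw [le_div_iff₀ (by positivity), mul_comm]
    refine le_trans ?_ (h.trans hb)
    refine mul_le_mul_of_nonneg_left (measureReal_mono fun ω hω => ?_) (by positivity)
    exact pow_le_pow_left₀ hr.le (le_of_lt hω) 2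
  rw [← ofReal_measureReal]
  exact ENNReal.ofReal_le_ofReal h2

/-- The mean square error of the mean of `k` independent samples of a real random variable. -/
theorem integral_mean_sub_sq {Y : Type*} [MeasurableSpace Y] {k : ℕ} (hk : 0 < k)
    (P : Measure Y) [IsProbabilityMeasure P] {f : Y → ℝ} (hf : MemLp f 2 P) :
    ∫ y, ((k : ℝ)⁻¹ * ∑ r : Fin k, f (y r) - ∫ x, f x ∂P) ^ 2 ∂(Measure.pi fun _ : Fin k => P) =
      (k : ℝ)⁻¹ * ∫ x, (f x - ∫ x, f x ∂P) ^ 2 ∂P := by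
  have hk' : (k : ℝ) ≠ 0 := by exact_mod_cast hk.ne'
  have hrow : ∀ r : Fin k, MemLp (fun y : Fin k → Y => f (y r)) 2 (Measure.pi fun _ => P) :=
    fun r => hf.comp_measurePreserving (measurePreserving_eval (fun _ : Fin k => P) r)
  have hmean : ∫ y, (k : ℝ)⁻¹ * ∑ r : Fin k, f (y r) ∂(Measure.pi fun _ : Fin k => P) =
      ∫ x, f x ∂P := by
    rw [integral_const_mul, integral_finsetSum _ fun r _ => (hrow r).integrable one_le_two]
    have : ∀ r : Fin k, ∫ y, f (y r) ∂(Measure.pi fun _ : Fin k => P) = ∫ x, f x ∂P := fun r =>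
      integral_comp_eval (μ := fun _ : Fin k => P) (i := r) hf.aestronglyMeasurable
    simp [this, hk']
  have hmeas : AEMeasurable (fun y : Fin k → Y => (k : ℝ)⁻¹ * ∑ r : Fin k, f (y r))
      (Measure.pi fun _ : Fin k => P) :=
    ((memLp_finsetSum _ fun r _ => hrow r).const_mul _).aemeasurable
  have h1 := variance_eq_integral hmeas
  rw [hmean] at h1
  rw [← h1, ← variance_eq_integral hf.aemeasurable, variance_const_mul]
  have hsum := variance_sum_pi (μ := fun _ : Fin k => P) (X := fun _ => f) (fun _ => hf)
  have h2 : (fun y : Fin k → Y => ∑ r, f (y r)) = ∑ r : Fin k, fun y => f (y r) := by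
    ext; simp
  rw [h2, hsum]
  simp only [Finset.sum_const, Finset.card_univ, Fintype.card_fin, nsmul_eq_mul]
  field_simp

theorem memLp_mean_sub {d k : ℕ} (P : Measure (EuclideanSpace ℝ (Fin d)))
    [IsProbabilityMeasure P] (hP : MemLp id 2 P) (a : EuclideanSpace ℝ (Fin d)) :
    MemLp (fun y : Fin k → EuclideanSpace ℝ (Fin d) => (k : ℝ)⁻¹ • ∑ r, y r - a) 2
      (Measure.pi fun _ => P) := by
  have hrow : ∀ r : Fin k, MemLp (fun y : Fin k → EuclideanSpace ℝ (Fin d) => y r) 2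
      (Measure.pi fun _ => P) := fun r =>
    hP.comp_measurePreserving (measurePreserving_eval (fun _ : Fin k => P) r)
  have h := memLp_finsetSum Finset.univ fun r _ => hrow r
  exact (h.const_smul ((k : ℝ)⁻¹)).sub (memLp_const a)

theorem integral_norm_sq_eq_sum {Ω : Type*} [MeasurableSpace Ω] {d : ℕ} (P : Measure Ω)
    {f : Ω → EuclideanSpace ℝ (Fin d)} (hf : MemLp f 2 P) :
    ∫ ω, ‖f ω‖ ^ 2 ∂P = ∑ j, ∫ ω, f ω j ^ 2 ∂P := by
  simp_rw [EuclideanSpace.real_norm_sq_eq]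
  exact integral_finsetSum _ fun j _ =>
    ((EuclideanSpace.proj (𝕜 := ℝ) j).comp_memLp' hf).integrable_sq

/-- The second moment of the centered noise `N(0, s I_d)`. -/
theorem integral_norm_sq_multivariateGaussian (d : ℕ) {s : ℝ} (hs : 0 ≤ s) :
    ∫ z, ‖z‖ ^ 2 ∂(multivariateGaussian 0 (s • (1 : Matrix (Fin d) (Fin d) ℝ))) = d * s := by
  set N := multivariateGaussian 0 (s • (1 : Matrix (Fin d) (Fin d) ℝ)) with hN
  have hps : (s • (1 : Matrix (Fin d) (Fin d) ℝ)).PosSemidef := Matrix.PosSemidef.one.smul hs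
  have hmem : ∀ j, MemLp (fun z : EuclideanSpace ℝ (Fin d) => z j) 2 N := fun j =>
    (EuclideanSpace.proj (𝕜 := ℝ) j).comp_memLp' IsGaussian.memLp_two_id
  rw [integral_norm_sq_eq_sum N (f := fun z => z) IsGaussian.memLp_two_id]
  have hj : ∀ j, ∫ z, z j ^ 2 ∂N = s := by
    intro j
    have hv := variance_eval_multivariateGaussian (μ := 0) hps j
    have hmean : ∫ z, z j ∂N = 0 := by
      have := (EuclideanSpace.proj (𝕜 := ℝ) j).integral_comp_comm
        (IsGaussian.integrable_id (μ := N))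
      simpa [hN] using this
    rw [← hN, variance_of_integral_eq_zero (hmem j).aemeasurable hmean] at hv
    simpa using hv
  simp [hj]

/-- The mean square error of the mean of `k` independent samples. -/
theorem integral_norm_mean_sub_sq {d k : ℕ} (hk : 0 < k)
    (P : Measure (EuclideanSpace ℝ (Fin d))) [IsProbabilityMeasure P] (hP : MemLp id 2 P) :
    ∫ y, ‖(k : ℝ)⁻¹ • ∑ r : Fin k, y r - ∫ x', x' ∂P‖ ^ 2 ∂(Measure.pi fun _ : Fin k => P) =
      (k : ℝ)⁻¹ * ∫ x, ‖x - ∫ x', x' ∂P‖ ^ 2 ∂P := by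
  rw [integral_norm_sq_eq_sum _ (memLp_mean_sub P hP _),
    integral_norm_sq_eq_sum P (f := fun x => x - ∫ x', x' ∂P) (hP.sub (memLp_const _)),
    Finset.mul_sum]
  refine Finset.sum_congr rfl fun j _ => ?_
  have hcoord : MemLp (fun x : EuclideanSpace ℝ (Fin d) => x j) 2 P :=
    (EuclideanSpace.proj (𝕜 := ℝ) j).comp_memLp' hP
  have hmean : ∫ x, x j ∂P = (∫ x, x ∂P) j :=
    (EuclideanSpace.proj (𝕜 := ℝ) j).integral_comp_comm (hP.integrable one_le_two)
  have h := integral_mean_sub_sq hk P hcoord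
  rw [hmean] at h
  simpa using h

/-! ### Independence of blocks and failure probability -/

/-- The mean of a block as the mean of a family of `k` rows. -/
theorem blockMean_eq {n d m k : ℕ} (h : m * k ≤ n) (x : Fin n → EuclideanSpace ℝ (Fin d))
    (p : Fin m) :
    blockMean k x p = (k : ℝ)⁻¹ • ∑ r : Fin k, x (Fin.castLE h (finProdFinEquiv (p, r))) := by
  rw [blockMean]
  congr 1
  symm
  -- `finProdFinEquiv (p, r)` has value `r + k * p`, the `r`-th row of block `p`.
  refine Finset.sum_bij (fun r _ => Fin.castLE h (finProdFinEquiv (p, r))) ?_ ?_ ?_ ?_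
  · intro r _
    simp only [Finset.mem_filter_univ, Fin.val_castLE, finProdFinEquiv_apply_val]
    have := r.2
    constructor <;> nlinarith
  · intro r _ r' _ hr
    simpa using hr
  · intro i hi
    simp only [Finset.mem_filter_univ] at hi
    refine ⟨⟨i - p * k, by have := hi.2; have := hi.1; rw [add_mul] at *; omega⟩, by simp, ?_⟩
    ext
    simp only [Fin.val_castLE, finProdFinEquiv_apply_val]
    have := hi.1
    rw [mul_comm k]
    omega
  · intros; rfl

/-- The block means of i.i.d. rows are i.i.d. -/
theorem map_blockMean {n d m k : ℕ} (h : m * k ≤ n)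
    (P : Measure (EuclideanSpace ℝ (Fin d))) [IsProbabilityMeasure P] :
    (Measure.pi fun _ : Fin n => P).map (fun x (p : Fin m) => blockMean k x p) =
      Measure.pi fun _ : Fin m => (Measure.pi fun _ : Fin k => P).map
        fun y => (k : ℝ)⁻¹ • ∑ r, y r := by
  set g : Fin m × Fin k → Fin n := fun q => Fin.castLE h (finProdFinEquiv q) with hg
  -- Disjointness of the blocks: an injectively indexed subfamily of i.i.d. rows is again i.i.d.
  have hinj : Function.Injective g :=
    (Fin.castLE_injective h).comp finProdFinEquiv.injective
  have h1 : (Measure.pi fun _ : Fin n => P).map (fun x q => x (g q)) =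
      Measure.pi fun _ : Fin m × Fin k => P := by
    have := Measure.map_infinitePi_infinitePi_of_inj (P := fun _ : Fin n => P) hinj
    simpa only [Measure.infinitePi_eq_pi] using this
  have h2 : (Measure.pi fun _ : Fin m × Fin k => P).map
      (MeasurableEquiv.curry (Fin m) (Fin k) (EuclideanSpace ℝ (Fin d))) =
      Measure.pi fun _ : Fin m => Measure.pi fun _ : Fin k => P := by
    have := Measure.infinitePi_map_curry (fun (_ : Fin m) (_ : Fin k) => P)
    simpa only [Measure.infinitePi_eq_pi] using this
  have h3 : (fun (x : Fin n → EuclideanSpace ℝ (Fin d)) (p : Fin m) => blockMean k x p) =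
      (fun (y : Fin m → Fin k → EuclideanSpace ℝ (Fin d)) p => (k : ℝ)⁻¹ • ∑ r, y p r) ∘
        MeasurableEquiv.curry (Fin m) (Fin k) (EuclideanSpace ℝ (Fin d)) ∘
          fun x q => x (g q) := by
    ext x p : 2
    exact blockMean_eq h x p
  have : IsProbabilityMeasure ((Measure.pi fun _ : Fin k => P).map
      fun y => (k : ℝ)⁻¹ • ∑ r, y r) := Measure.isProbabilityMeasure_map (by fun_prop)
  rw [h3, ← Measure.map_map (by fun_prop) (by fun_prop),
    ← Measure.map_map (by fun_prop) (by fun_prop), h1, h2]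
  exact Measure.pi_map_pi
    (f := fun (_ : Fin m) (y : Fin k → EuclideanSpace ℝ (Fin d)) => (k : ℝ)⁻¹ • ∑ r, y r)
    fun _ => by fun_prop

/-- The median of noisy block means is accurate when single block means and single noise vectors
are small with large probability. -/
theorem measure_lt_norm_noisyMedian_sub_le {n m k d : ℕ} (hn : m * k ≤ n)
    (G : MedianSelector m d) (P : Measure (EuclideanSpace ℝ (Fin d))) [IsProbabilityMeasure P]
    (a : EuclideanSpace ℝ (Fin d)) {r s : ℝ}
    (hP : (Measure.pi fun _ : Fin k => P) {y | r < ‖(k : ℝ)⁻¹ • ∑ i, y i - a‖} ≤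
      ENNReal.ofReal (Real.exp (-12)))
    (hs : multivariateGaussian 0 (s • (1 : Matrix (Fin d) (Fin d) ℝ)) {z | r < ‖z‖} ≤
      ENNReal.ofReal (Real.exp (-12))) :
    ((Measure.pi fun _ : Fin n => P).prod (noiseLaw m d s))
      {q | 8 * r < ‖G.toFun (fun p => blockMean k q.1 p + q.2 p) - a‖} ≤
      2 * ENNReal.ofReal (Real.exp (-m)) := by
  classical
  set A : Set (EuclideanSpace ℝ (Fin d)) := {y | r < ‖y - a‖} with hA
  set B : Set (EuclideanSpace ℝ (Fin d)) := {z | r < ‖z‖} with hB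
  have hAm : MeasurableSet A := measurableSet_lt measurable_const (by fun_prop)
  have hBm : MeasurableSet B := measurableSet_lt measurable_const (by fun_prop)
  set Q := (Measure.pi fun _ : Fin k => P).map fun y => (k : ℝ)⁻¹ • ∑ i, y i with hQ
  have : IsProbabilityMeasure Q := Measure.isProbabilityMeasure_map (by fun_prop)
  have hQA : Q A ≤ ENNReal.ofReal (Real.exp (-12)) := by
    rw [hQ, Measure.map_apply (by fun_prop) hAm]
    exact hP
  set S : Set (Fin m → EuclideanSpace ℝ (Fin d)) :=
    {y | m ≤ 6 * (Finset.univ.filter fun p => y p ∈ A).card} with hS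
  set T : Set (Fin m → EuclideanSpace ℝ (Fin d)) :=
    {y | m ≤ 6 * (Finset.univ.filter fun p => y p ∈ B).card} with hT
  set f : (Fin n → EuclideanSpace ℝ (Fin d)) → Fin m → EuclideanSpace ℝ (Fin d) :=
    fun x p => blockMean k x p with hf
  have hfm : Measurable f := by
    refine measurable_pi_lambda _ fun p => ?_
    simp only [hf]
    unfold blockMean
    fun_prop
  have hSle : (Measure.pi fun _ : Fin n => P) (f ⁻¹' S) ≤ ENNReal.ofReal (Real.exp (-m)) := by
    refine (Measure.le_map_apply hfm.aemeasurable S).trans ?_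
    rw [map_blockMean hn]
    exact pi_card_filter_mem_le Q m hAm hQA
  have hTle : noiseLaw m d s T ≤ ENNReal.ofReal (Real.exp (-m)) :=
    pi_card_filter_mem_le _ m hBm hs
  have hsub : {q : (Fin n → EuclideanSpace ℝ (Fin d)) × (Fin m → EuclideanSpace ℝ (Fin d)) |
      8 * r < ‖G.toFun (fun p => blockMean k q.1 p + q.2 p) - a‖} ⊆
      (f ⁻¹' S) ×ˢ Set.univ ∪ Set.univ ×ˢ T := by
    intro q hq
    by_contra hcon
    simp only [Set.mem_union, Set.mem_prod, Set.mem_univ, and_true, true_and, not_or] at hcon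
    obtain ⟨h1, h2⟩ := hcon
    have h1' : 6 * (Finset.univ.filter fun p => f q.1 p ∈ A).card < m := not_le.1 h1
    have h2' : 6 * (Finset.univ.filter fun p => q.2 p ∈ B).card < m := not_le.1 h2
    have hle : (Finset.univ.filter fun p : Fin m =>
        2 * r < ‖blockMean k q.1 p + q.2 p - a‖).card ≤
        (Finset.univ.filter fun p => f q.1 p ∈ A).card +
          (Finset.univ.filter fun p => q.2 p ∈ B).card := by
      -- A noisy block mean is off by more than `2r` only if its mean or its noise is off by more
      -- than `r`. Two counts below `m/6` leave fewer than `m/3` bad points, and the median bound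
      -- gives `4 · 2r = 8r`.
      refine (Finset.card_le_card ?_).trans (Finset.card_union_le _ _)
      intro p hp
      simp only [Finset.mem_filter_univ, Finset.mem_union] at hp ⊢
      by_contra hpc
      rw [not_or] at hpc
      have h3 : ‖blockMean k q.1 p - a‖ ≤ r := not_lt.1 hpc.1
      have h4 : ‖q.2 p‖ ≤ r := not_lt.1 hpc.2
      have h5 := norm_add_le (blockMean k q.1 p - a) (q.2 p)
      rw [show blockMean k q.1 p - a + q.2 p = blockMean k q.1 p + q.2 p - a by abel] at h5
      linarith
    have h6 := (G.isGeometricMedian fun p => blockMean k q.1 p + q.2 p).norm_sub_le a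
      (r := 2 * r) (by omega)
    have h7 : 8 * r < ‖G.toFun (fun p => blockMean k q.1 p + q.2 p) - a‖ := hq
    linarith
  calc _ ≤ ((Measure.pi fun _ : Fin n => P).prod (noiseLaw m d s))
        ((f ⁻¹' S) ×ˢ Set.univ ∪ Set.univ ×ˢ T) := measure_mono hsub
    _ ≤ _ := measure_union_le _ _
    _ = (Measure.pi fun _ : Fin n => P) (f ⁻¹' S) + noiseLaw m d s T := by
        rw [Measure.prod_prod, Measure.prod_prod, measure_univ, measure_univ, mul_one, one_mul]
    _ ≤ _ := by
        rw [two_mul]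
        exact add_le_add hSle hTle

theorem meanEstimator_comp {n d : ℕ} (c ε β : ℝ) (G : MedianSelector (numBlocks β) d)
    (μ : Measure (Fin n → EuclideanSpace ℝ (Fin d))) [SFinite μ] :
    meanEstimator c ε β G ∘ₘ μ =
      (μ.prod (noiseLaw (numBlocks β) d (noiseVariance d (n / numBlocks β) c ε))).map
        fun q => G.toFun fun p => blockMean (n / numBlocks β) q.1 p + q.2 p := by
  have hF := measurable_noisyMedian (n := n) (n / numBlocks β) G
  refine Measure.ext_of_lintegral _ fun g hg => ?_
  rw [Measure.lintegral_bind (Kernel.aemeasurable _) hg.aemeasurable, lintegral_map hg hF,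
    lintegral_prod (fun q : (Fin n → EuclideanSpace ℝ (Fin d)) ×
      (Fin (numBlocks β) → EuclideanSpace ℝ (Fin d)) =>
        g (G.toFun fun p => blockMean (n / numBlocks β) q.1 p + q.2 p))
      (hg.comp hF).aemeasurable]
  refine lintegral_congr fun x => ?_
  have hFx : Measurable fun z : Fin (numBlocks β) → EuclideanSpace ℝ (Fin d) =>
      G.toFun fun p => blockMean (n / numBlocks β) x p + z p := G.measurable.comp (by fun_prop)
  rw [meanEstimator_apply, lintegral_map hg hFx]

/-! ### Choice of constants and accuracy -/

theorem numBlocks_pos {β : ℝ} (h0 : 0 < β) (h1 : β < 1) : 0 < numBlocks β := by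
  rw [numBlocks, Nat.ceil_pos]
  have : 0 < Real.log (1 / β) := Real.log_pos ((one_lt_div h0).2 h1)
  positivity

/-- Already `m/200 ≥ log (1/β)`; since `m ≥ 1`, the remaining `199m/200` exceeds `log 2` and absorbs
the factor `2` from the union bound. -/
theorem two_mul_exp_neg_numBlocks_le {β : ℝ} (h0 : 0 < β) (h1 : β < 1) :
    2 * Real.exp (-(numBlocks β)) ≤ β := by
  have hm : (1 : ℝ) ≤ numBlocks β := by exact_mod_cast numBlocks_pos h0 h1
  have hL : 200 * Real.log (1 / β) ≤ numBlocks β := Nat.le_ceil _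
  rw [one_div, Real.log_inv] at hL
  have h2 := Real.log_two_lt_d9
  calc 2 * Real.exp (-(numBlocks β)) = Real.exp (Real.log 2 - numBlocks β) := by
        rw [sub_eq_add_neg, Real.exp_add, Real.exp_log two_pos]
    _ ≤ Real.exp (Real.log β) := Real.exp_le_exp.2 (by linarith)
    _ = β := Real.exp_log h0

/-- The block length is at least proportional to the sample size divided by
`max 1 (log (1/β))`. -/
theorem le_div_numBlocks {n : ℕ} {β K D : ℝ} (h0 : 0 < β) (h1 : β < 1) (hn : numBlocks β ≤ n)
    (hKD : 402 * K * (max 1 (Real.log (1 / β)) * D) ≤ n) :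
    K * D ≤ (n / numBlocks β : ℕ) := by
  set m := numBlocks β with hm
  have hmpos : 0 < m := numBlocks_pos h0 h1
  have hk : 1 ≤ n / m := (Nat.one_le_div_iff hmpos).2 hn
  have hnk : n < m * (n / m + 1) := Nat.lt_mul_div_succ n hmpos
  -- Rounding down costs at most a factor `2` because `n / m ≥ 1`. With `m ≤ 201 M` below, this
  -- yields `402 = 2 · 201`.
  have hnk' : (n : ℝ) ≤ 2 * m * (n / m : ℕ) := by
    have : n ≤ 2 * m * (n / m) := by nlinarith
    exact_mod_cast this
  set M := max 1 (Real.log (1 / β)) with hM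
  have hM1 : 1 ≤ M := le_max_left _ _
  have hM2 : Real.log (1 / β) ≤ M := le_max_right _ _
  have hmM : (m : ℝ) ≤ 201 * M := by
    have hL : 0 < Real.log (1 / β) := Real.log_pos ((one_lt_div h0).2 h1)
    have : (m : ℝ) < 200 * Real.log (1 / β) + 1 := Nat.ceil_lt_add_one (by positivity)
    linarith
  have h2 : 402 * M * (K * D) ≤ 402 * M * (n / m : ℕ) := by
    calc 402 * M * (K * D) = 402 * K * (M * D) := by ring
      _ ≤ n := hKD
      _ ≤ 2 * m * (n / m : ℕ) := hnk'
      _ ≤ 2 * (201 * M) * (n / m : ℕ) := by gcongr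
      _ = _ := by ring
  exact le_of_mul_le_mul_left h2 (by positivity)

/-- The accuracy of the mean estimator. -/
theorem le_real_meanEstimator_comp {c : ℝ} (hc : 0 < c) {d n : ℕ} {α β ε : ℝ} (hd : 1 ≤ d)
    (hα : 0 < α) (hβ : 0 < β) (hβ1 : β < 1) (hε : 0 < ε) (hn : numBlocks β ≤ n)
    (G : MedianSelector (numBlocks β) d)
    (hC : 402 * (1 + 64 * c * Real.exp 12) *
      (max 1 (Real.log (1 / β)) * (d / α ^ 2 + d / (α * Real.sqrt ε))) ≤ n)
    (P : Measure (EuclideanSpace ℝ (Fin d))) [IsProbabilityMeasure P] (hP : MemLp id 2 P)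
    (hPc : ∫ x, ‖x - ∫ x', x' ∂P‖ ^ 2 ∂P ≤ c) :
    1 - β ≤ ((meanEstimator (n := n) c ε β G) ∘ₘ (Measure.pi fun _ => P)).real
      {y | ‖y - ∫ x, x ∂P‖ ≤ α} := by
  set a := ∫ x, x ∂P with ha
  have hk := le_div_numBlocks hβ hβ1 hn hC
  have hk0 : 0 < n / numBlocks β := Nat.div_pos hn (numBlocks_pos hβ hβ1)
  have hd' : (1 : ℝ) ≤ d := by exact_mod_cast hd
  rw [meanEstimator_comp]
  have hF := measurable_noisyMedian (n := n) (n / numBlocks β) G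
  have hmk : numBlocks β * (n / numBlocks β) ≤ n := Nat.mul_div_le _ _
  set s := noiseVariance d (n / numBlocks β) c ε with hs
  have hmβ := two_mul_exp_neg_numBlocks_le hβ hβ1
  generalize numBlocks β = m at *
  generalize n / m = k at *
  set E := Real.exp 12 with hE
  have hE0 : 0 < E := Real.exp_pos _
  have hEinv : Real.exp (-12) = E⁻¹ := Real.exp_neg 12
  have hk' : (0 : ℝ) < k := by exact_mod_cast hk0
  have hsε : 0 < √ε := Real.sqrt_pos.2 hε
  have hs0 : 0 ≤ s := by
    rw [hs, noiseVariance]; positivity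
  -- Chebyshev at radius `α / 8` (so that `8r = α`) and level `exp (-12)` requires exactly this: `64
  -- = 8²`.
  have hK1 : 64 * c * E ≤ k * α ^ 2 := by
    have h1 : (1 + 64 * c * E) * (1 / α ^ 2) ≤ k := by
      refine le_trans ?_ hk
      have : 0 ≤ (d : ℝ) / (α * √ε) := by positivity
      have h2 : 1 / α ^ 2 ≤ d / α ^ 2 + d / (α * √ε) := by
        have : 1 / α ^ 2 ≤ d / α ^ 2 := by gcongr
        linarith
      gcongr
    rw [mul_one_div, div_le_iff₀ (by positivity)] at h1
    linarith
  have hK2 : (1 + 64 * c * E) * d ≤ k * (α * √ε) := by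
    have h1 : (1 + 64 * c * E) * (d / (α * √ε)) ≤ k := by
      refine le_trans ?_ hk
      have : 0 ≤ (d : ℝ) / α ^ 2 := by positivity
      gcongr
      linarith
    rwa [← mul_div_assoc, div_le_iff₀ (by positivity)] at h1
  have hblock : (Measure.pi fun _ : Fin k => P)
      {y | α / 8 < ‖(k : ℝ)⁻¹ • ∑ i, y i - a‖} ≤ ENNReal.ofReal (Real.exp (-12)) := by
    refine (measure_lt_norm_le (b := (k : ℝ)⁻¹ * c) _ (memLp_mean_sub P hP a) (by positivity)
      ?_).trans (ENNReal.ofReal_le_ofReal ?_)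
    · rw [integral_norm_mean_sub_sq hk0 P hP]
      gcongr
    · rw [hEinv, div_le_iff₀ (by positivity), inv_mul_eq_div, inv_mul_eq_div,
        div_le_div_iff₀ hk' hE0]
      nlinarith
  have hnoise : multivariateGaussian 0 (s • (1 : Matrix (Fin d) (Fin d) ℝ)) {z | α / 8 < ‖z‖} ≤
      ENNReal.ofReal (Real.exp (-12)) := by
    refine (measure_lt_norm_le (f := fun z => z) (b := d * s) _ IsGaussian.memLp_two_id
      (by positivity) (integral_norm_sq_multivariateGaussian d hs0).le).trans
      (ENNReal.ofReal_le_ofReal ?_)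
    -- The noise has second moment `d s = d² c / (2 k² ε)`, whence `d²`. The summand `1` in the
    -- constant ensures `(1 + 64cE)² ≥ 64cE` even for small `c`.
    have h1 : (64 * c * E) * (d : ℝ) ^ 2 ≤ (k : ℝ) ^ 2 * α ^ 2 * ε := by
      have h2 : ((1 + 64 * c * E) * d) ^ 2 ≤ (k * (α * √ε)) ^ 2 := by
        gcongr
      have h3 : (k * (α * √ε)) ^ 2 = (k : ℝ) ^ 2 * α ^ 2 * ε := by
        rw [mul_pow, mul_pow, Real.sq_sqrt hε.le]; ring
      rw [h3] at h2
      refine le_trans ?_ h2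
      rw [mul_pow]
      have hce : 0 < c * E := by positivity
      gcongr
      nlinarith
    rw [hEinv, div_le_iff₀ (by positivity), hs, noiseVariance, inv_mul_eq_div, ← mul_div_assoc,
      div_le_div_iff₀ (by positivity) hE0]
    have h2 : 0 ≤ (k : ℝ) ^ 2 * α ^ 2 * ε := by positivity
    linarith
  have hfar := measure_lt_norm_noisyMedian_sub_le hmk G P a hblock hnoise
  have hball : MeasurableSet {y : EuclideanSpace ℝ (Fin d) | ‖y - a‖ ≤ α} :=
    measurableSet_le (by fun_prop) measurable_const
  rw [map_measureReal_apply hF hball]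
  have hcompl := probReal_compl_eq_one_sub
    (μ := (Measure.pi fun _ : Fin n => P).prod (noiseLaw m d s)) (hF hball)
  have hle : ((Measure.pi fun _ : Fin n => P).prod (noiseLaw m d s)).real
      ((fun q => G.toFun fun p => blockMean k q.1 p + q.2 p) ⁻¹' {y | ‖y - a‖ ≤ α})ᶜ ≤ β := by
    refine le_trans ?_ hmβ
    refine ENNReal.toReal_le_of_le_ofReal (by positivity) ?_
    rw [ENNReal.ofReal_mul two_pos.le, ENNReal.ofReal_ofNat]
    refine le_trans (measure_mono fun q hq => ?_) hfar
    have h1 : α < ‖G.toFun (fun p => blockMean k q.1 p + q.2 p) - a‖ := not_le.1 hq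
    change 8 * (α / 8) < _
    linarith
  linarith

end MIPrivacy

theorem mainTheorem10 (c : ℝ) (hc : 0 < c) :
    ∃ C : ℝ, 0 < C ∧
      ∀ (d n : ℕ) (α β ε : ℝ), 1 ≤ d → 0 < α → 0 < β → β < 1 → 0 < ε →
        MIPrivacy.numBlocks β ≤ n →
        ∀ G : MIPrivacy.MedianSelector (MIPrivacy.numBlocks β) d,
          MIPrivacy.IsMIDP (MIPrivacy.meanEstimator (n := n) c ε β G) ε
              (MIPrivacy.secondMomentClass n d c) ∧
          (C * (max 1 (Real.log (1 / β)) * (d / α ^ 2 + d / (α * Real.sqrt ε))) ≤ n →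
            ∀ (P : Measure (EuclideanSpace ℝ (Fin d))) [IsProbabilityMeasure P],
              MemLp id 2 P → ∫ x, ‖x - ∫ x', x' ∂P‖ ^ 2 ∂P ≤ c →
              1 - β ≤
                ((MIPrivacy.meanEstimator (n := n) c ε β G) ∘ₘ (Measure.pi fun _ => P)).real
                  {y | ‖y - ∫ x, x ∂P‖ ≤ α}) := by
  refine ⟨402 * (1 + 64 * c * Real.exp 12), by positivity,
    fun d n α β ε hd hα hβ hβ1 hε hn G => ⟨?_, fun hC P _ hP hPc => ?_⟩⟩
  · exact MIPrivacy.isMIDP_meanEstimator hd hc hε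
      (Nat.div_pos hn (MIPrivacy.numBlocks_pos hβ hβ1)) G
  · exact MIPrivacy.le_real_meanEstimator_comp hc hd hα hβ hβ1 hε hn G hC P hP hPc
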